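/- Let $\bar A\in\mathbb{R}^{n\times n}$, of which only the location of zeroes and non-zeroes matters, and let $\mathcal{D}(\bar A)$ be the digraph with vertices $x_1,\dots,x_n$ and an edge from $x_j$ to $x_i$ exactly when $\bar A_{ij}\neq 0$. A pair $(A,B)\in\mathbb{R}^{n\times n}\times\mathbb{R}^{n\times p}$ is completely controllable if every state of $\dot x=Ax+Bu$ can be steered to every other state in finite time. A pair $(A_0,B_0)$ is structurally controllable if for every $\epsilon>0$ there are completely controllable pairs $(A_1,B_1)$ and $(A_2,B_2)$ with the same location of zeroes and non-zeroes as $(A_0,B_0)$ such that $\|A_1-A_0\|>\epsilon$, $\|B_1-B_0\|>\epsilon$ and $\|A_2-A_0\|<\epsilon$, $\|B_2-B_0\|<\epsilon$ (the condition $\|A_1-A_0\|>\epsilon$ is dropped if $A_0=0$, and $\|B_1-B_0\|>\epsilon$ if $B_0=0$). A matrix $\bar B\in\mathbb{R}^{n\times p}$ consists of $p$ dedicated inputs if each of its columns has exactly one non-zero entry. A state stem is an elementary path in $\mathcal{D}(\bar A)$ (all vertices distinct) or a single vertex; its root and its tip are its first and its last vertex. State cacti are the subgraphs of $\mathcal{D}(\bar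 A)$ defined recursively as follows: a state stem is a state cactus; a state cactus together with a cycle of $\mathcal{D}(\bar A)$ (possibly a self-loop) that has no vertex in common with it and an edge of $\mathcal{D}(\bar A)$ from a vertex of the cactus other than its tip to a vertex of the cycle is a state cactus with the same root and tip. Then the minimum number $p$ such that some $\bar B\in\mathbb{R}^{n\times p}$ consisting of $p$ dedicated inputs makes $(\bar A,\bar B)$ structurally controllable is equal to the minimum number of pairwise vertex-disjoint state cacti that together contain all vertices of $\mathcal{D}(\bar A)$. (Both minima exist.) -/

import Mathlib

namespace StructuralControl

/-- The pair `(A, B)` is completely controllable: for the system `ẋ = A x + B u`, every state can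
be steered to every other state in some finite time `T > 0` by a continuous control `u`. -/
def Controllable {n p : ℕ} (A : Matrix (Fin n) (Fin n) ℝ) (B : Matrix (Fin n) (Fin p) ℝ) : Prop :=
  ∀ x₀ x₁ : Fin n → ℝ, ∃ T : ℝ, 0 < T ∧
    ∃ (u : ℝ → Fin p → ℝ) (x : ℝ → Fin n → ℝ), Continuous u ∧
      (∀ t : ℝ, HasDerivAt x (A.mulVec (x t) + B.mulVec (u t)) t) ∧ x 0 = x₀ ∧ x T = x₁

/-- Two matrices have the same structure (the same location of zeroes and non-zeroes). -/
def SameStructure {m n : ℕ} (M N : Matrix (Fin m) (Fin n) ℝ) : Prop :=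
  ∀ i j, M i j = 0 ↔ N i j = 0

/-- `‖M - N‖ < ε` in the entrywise maximum norm. -/
def NormDistLT {m n : ℕ} (M N : Matrix (Fin m) (Fin n) ℝ) (ε : ℝ) : Prop :=
  ∀ i j, |M i j - N i j| < ε

/-- `‖M - N‖ > ε` in the entrywise maximum norm (for `ε > 0`). -/
def NormDistGT {m n : ℕ} (M N : Matrix (Fin m) (Fin n) ℝ) (ε : ℝ) : Prop :=
  ∃ i j, ε < |M i j - N i j|

/-- Structural controllability of the pair `(A₀, B₀)`: for every `ε > 0` there are completely
controllable pairs with the same structure as `(A₀, B₀)` both at distance more than `ε` and at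
distance less than `ε` from `(A₀, B₀)`. A zero matrix is the only matrix with its structure, so
for it the requirement to be far away is void. -/
def StructurallyControllable {n p : ℕ} (A₀ : Matrix (Fin n) (Fin n) ℝ)
    (B₀ : Matrix (Fin n) (Fin p) ℝ) : Prop :=
  ∀ ε : ℝ, 0 < ε →
    (∃ (A₁ : Matrix (Fin n) (Fin n) ℝ) (B₁ : Matrix (Fin n) (Fin p) ℝ),
      SameStructure A₁ A₀ ∧ SameStructure B₁ B₀ ∧ Controllable A₁ B₁ ∧
      (A₀ ≠ 0 → NormDistGT A₁ A₀ ε) ∧ (B₀ ≠ 0 → NormDistGT B₁ B₀ ε)) ∧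
    (∃ (A₂ : Matrix (Fin n) (Fin n) ℝ) (B₂ : Matrix (Fin n) (Fin p) ℝ),
      SameStructure A₂ A₀ ∧ SameStructure B₂ B₀ ∧ Controllable A₂ B₂ ∧
      NormDistLT A₂ A₀ ε ∧ NormDistLT B₂ B₀ ε)

/-- All inputs are dedicated: each column of the input matrix has exactly one non-zero entry. -/
def Dedicated {n p : ℕ} (B : Matrix (Fin n) (Fin p) ℝ) : Prop :=
  ∀ j, ∃! i, B i j ≠ 0

/-- The state digraph of `ẋ = A x`: there is an edge from `x_j` to `x_i` iff `A i j ≠ 0`, that is,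
iff `x_j` acts on the derivative of `x_i`. -/
def stateDigraph {n : ℕ} (A : Matrix (Fin n) (Fin n) ℝ) : Digraph (Fin n) where
  Adj j i := A i j ≠ 0

section Cacti

variable {V : Type*}

/-- The list `l` of vertices is an elementary path of `D`, possibly a single vertex. -/
def IsElementaryPath (D : Digraph V) (l : List V) : Prop :=
  l ≠ [] ∧ l.Nodup ∧ l.IsChain D.Adj

/-- The list `c` of vertices is a cycle of `D`: an elementary path together with an edge from its
last to its first vertex. A self-loop is a cycle. -/
def IsCycle (D : Digraph V) (c : List V) : Prop :=
  IsElementaryPath D c ∧ ∀ a ∈ c.getLast?, ∀ b ∈ c.head?, D.Adj a b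

/-- The edges between consecutive vertices of `l`. -/
def pathEdges (l : List V) : Set (V × V) :=
  {e | [e.1, e.2] <:+: l}

/-- The edges of the cycle through the vertices of `c`. -/
def cycleEdges (c : List V) : Set (V × V) :=
  pathEdges c ∪ {e | e.1 ∈ c.getLast? ∧ e.2 ∈ c.head?}

/-- `IsCactus D S E r t`: the subgraph of `D` with vertex set `S` and edge set `E` is a cactus with
root `r` and tip `t`. A stem is a cactus; a cactus connected, by an edge `(v, w)` from a vertex `v`
other than the tip, to a vertex `w` of a cycle disjoint from it is again a cactus, with the same
root and tip. -/
inductive IsCactus (D : Digraph V) : Set V → Set (V × V) → V → V → Prop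
  | stem (l : List V) (r t : V) (hl : IsElementaryPath D l) (hr : l.head? = some r)
      (ht : l.getLast? = some t) : IsCactus D {x | x ∈ l} (pathEdges l) r t
  | bud (S : Set V) (E : Set (V × V)) (r t : V) (c : List V) (v w : V)
      (hS : IsCactus D S E r t) (hc : IsCycle D c) (hdisj : ∀ x ∈ c, x ∉ S)
      (hv : v ∈ S) (hvt : v ≠ t) (hw : w ∈ c) (hvw : D.Adj v w) :
      IsCactus D (S ∪ {x | x ∈ c}) (E ∪ cycleEdges c ∪ {(v, w)}) r t

/-- `D` is spanned by `k` pairwise vertex-disjoint cacti. -/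
def SpannedByCacti (D : Digraph V) (k : ℕ) : Prop :=
  ∃ (S : Fin k → Set V) (E : Fin k → Set (V × V)) (r t : Fin k → V),
    (∀ a, IsCactus D (S a) (E a) (r a) (t a)) ∧
    (∀ a b, a ≠ b → Disjoint (S a) (S b)) ∧
    (⋃ a, S a) = Set.univ

end Cacti

end StructuralControl

/-! Two constructions bound each minimum by the other. From cacti to inputs: put one input at the
root of each cactus. The edges of a cactus can be weighted so that no left eigenvector of its matrix
vanishes at the root (`IsCactus.hasRealization`, by induction over the buds). Together the cacti
give a matrix `M` supported on edges of the digraph for which Kalman's condition holds. That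
condition is the non-vanishing of a polynomial, so it also holds at matrices close to `A` with
exactly the structure of `A`, and scaling carries these far away
(`structurallyControllable_of_observable`). From inputs to cacti: take a controllable pair with the
given structure. The rows of `[A B]` are independent, so by Hall's theorem the states without input
have pairwise distinct predecessors; moreover every nonempty set of such states is entered by an
edge. From this `spannedByCacti_of_matching` grows one cactus out of each state with an input. There
are at most `p` of those, which suffices for the minima to agree. -/

namespace StructuralControl

open Matrix

/-! ### Controllability from Kalman's condition. -/

section ODE

open scoped Matrix.Norms.Operator

variable {n p : ℕ}

theorem hasDerivAt_mulVec {m n : ℕ} {M : ℝ → Matrix (Fin m) (Fin n) ℝ}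
    {M' : Matrix (Fin m) (Fin n) ℝ}
    {w : ℝ → Fin n → ℝ} {w' : Fin n → ℝ} {t : ℝ} (hM : HasDerivAt M M' t)
    (hw : HasDerivAt w w' t) :
    HasDerivAt (fun s => M s *ᵥ w s) (M' *ᵥ w t + M t *ᵥ w') t := by
  rw [hasDerivAt_pi]
  intro i
  have hMij : ∀ j, HasDerivAt (fun s => M s i j) (M' i j) t := fun j =>
    ((LinearMap.toContinuousLinearMap (Matrix.entryLinearMap ℝ ℝ i j)).hasFDerivAt).comp_hasDerivAt
      t hM
  have hwj := hasDerivAt_pi.1 hw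
  have := HasDerivAt.fun_sum (u := Finset.univ) (fun j _ => (hMij j).mul (hwj j))
  simpa [Matrix.mulVec, dotProduct, Finset.sum_add_distrib] using this

theorem hasDerivAt_exp_smul (A : Matrix (Fin n) (Fin n) ℝ) (t : ℝ) :
    HasDerivAt (fun s : ℝ => NormedSpace.exp (s • A)) (A * NormedSpace.exp (t • A)) t :=
  hasDerivAt_exp_smul_const' A t

theorem exp_neg_smul_mul_exp_smul (A : Matrix (Fin n) (Fin n) ℝ) (t : ℝ) :
    NormedSpace.exp ((-t) • A) * NormedSpace.exp (t • A) = 1 := by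
  rw [← Matrix.exp_add_of_commute _ _ ((Commute.refl A).smul_left _ |>.smul_right _)]
  simp

theorem continuous_exp_neg_smul (A : Matrix (Fin n) (Fin n) ℝ) :
    Continuous (fun s : ℝ => NormedSpace.exp ((-s) • A)) := by
  have : Continuous (fun s : ℝ => NormedSpace.exp (s • A)) :=
    continuous_iff_continuousAt.2 fun t => (hasDerivAt_exp_smul A t).continuousAt
  exact this.comp continuous_neg

/-- If the row vectors `y e^{-sA} B` vanish for all `s ∈ (0, 1)`, then so do all the `z Aᵏ B`, where
`z = y e^{-A/2}`. -/
theorem vecMul_pow_eq_zero_of_exp {A : Matrix (Fin n) (Fin n) ℝ} {B : Matrix (Fin n) (Fin p) ℝ}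
    {y : Fin n → ℝ}
    (h : ∀ s ∈ Set.Ioo (0 : ℝ) 1, y ᵥ* (NormedSpace.exp ((-s) • A) * B) = 0) (k : ℕ) :
    (y ᵥ* NormedSpace.exp ((-(1 / 2 : ℝ)) • A)) ᵥ* (A ^ k * B) = 0 := by
  -- Vanishing on an open interval can be differentiated in `s`, and each derivative brings down a
  -- factor `-A`.
  have key : ∀ k : ℕ, ∀ s ∈ Set.Ioo (0 : ℝ) 1,
      (A ^ k * NormedSpace.exp ((-s) • A) * B)ᵀ *ᵥ y = 0 := by
    intro k
    induction k with
    | zero => intro s hs; rw [mulVec_transpose, pow_zero, Matrix.one_mul]; exact h s hs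
    | succ k ih =>
      intro s hs
      let L : Matrix (Fin n) (Fin n) ℝ →ₗ[ℝ] Matrix (Fin p) (Fin n) ℝ :=
        { toFun := fun X => (A ^ k * X * B)ᵀ
          map_add' := by intro X Y; simp [mul_add, Matrix.add_mul]
          map_smul' := by intro c X; simp }
      have h1 : HasDerivAt (fun s : ℝ => NormedSpace.exp ((-s) • A))
          (-(A * NormedSpace.exp ((-s) • A))) s := by
        have := (hasDerivAt_exp_smul A (-s)).scomp s (hasDerivAt_neg s)
        rw [neg_one_smul] at this
        exact this
      have h2 := (LinearMap.toContinuousLinearMap L).hasFDerivAt.comp_hasDerivAt s h1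
      have h3 : HasDerivAt (fun s : ℝ => (A ^ k * NormedSpace.exp ((-s) • A) * B)ᵀ *ᵥ y) _ s :=
        hasDerivAt_mulVec h2 (hasDerivAt_const s y)
      have h4 : (fun s : ℝ => (A ^ k * NormedSpace.exp ((-s) • A) * B)ᵀ *ᵥ y) =ᶠ[nhds s]
          fun _ => 0 := by
        filter_upwards [isOpen_Ioo.mem_nhds hs] with r hr using ih r hr
      have h5 := (HasDerivAt.congr_of_eventuallyEq h3 h4.symm).unique
        (hasDerivAt_const s 0)
      have h6 : L (-(A * NormedSpace.exp ((-s) • A))) *ᵥ y = 0 := by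
        rw [mulVec_zero, add_zero] at h5
        exact h5
      rw [map_neg, neg_mulVec, neg_eq_zero] at h6
      rw [← h6]
      simp [L, pow_succ, Matrix.mul_assoc]
  have h1 := key k (1 / 2) (by norm_num)
  rw [mulVec_transpose] at h1
  rw [vecMul_vecMul, ← h1, ← Matrix.mul_assoc]
  congr 2
  have : Commute A (NormedSpace.exp ((-(1 / 2 : ℝ)) • A)) :=
    ((Commute.refl A).smul_right _).exp_right
  exact (this.pow_left k).eq.symm

/-- If the vectors `∫₀¹ e^{-sA} B u(s) ds` did not fill the space, some `y ≠ 0` would annihilate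
them all. The control `u(s) = y e^{-sA} B` then makes the integral of `|y e^{-sA} B|²` zero, so this
row vanishes on `(0, 1)` and the hypothesis applies to `y e^{-A/2}`. -/
theorem controllable_of_observable {A : Matrix (Fin n) (Fin n) ℝ} {B : Matrix (Fin n) (Fin p) ℝ}
    (h : ∀ y : Fin n → ℝ, (∀ k : ℕ, y ᵥ* (A ^ k * B) = 0) → y = 0) : Controllable A B := by
  have hcont : ∀ u : ℝ → Fin p → ℝ, Continuous u →
      Continuous fun s : ℝ => NormedSpace.exp ((-s) • A) *ᵥ (B *ᵥ u s) := fun u hu =>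
    (continuous_exp_neg_smul A).matrix_mulVec (continuous_const.matrix_mulVec hu)
  let W : Submodule ℝ (Fin n → ℝ) :=
    { carrier := {v | ∃ u : ℝ → Fin p → ℝ, Continuous u ∧
        ∫ s in (0 : ℝ)..1, NormedSpace.exp ((-s) • A) *ᵥ (B *ᵥ u s) = v}
      zero_mem' := ⟨0, continuous_zero, by simp⟩
      add_mem' := by
        rintro _ _ ⟨u, hu, rfl⟩ ⟨v, hv, rfl⟩
        refine ⟨u + v, hu.add hv, ?_⟩
        rw [← intervalIntegral.integral_add ((hcont u hu).intervalIntegrable _ _)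
          ((hcont v hv).intervalIntegrable _ _)]
        simp [mulVec_add]
      smul_mem' := by
        rintro c _ ⟨u, hu, rfl⟩
        refine ⟨c • u, hu.const_smul c, ?_⟩
        rw [← intervalIntegral.integral_smul]
        simp [mulVec_smul] }
  have hW : W = ⊤ := by
    by_contra hne
    obtain ⟨φ, hφ, hle⟩ := W.exists_le_ker_of_lt_top (lt_top_iff_ne_top.2 hne)
    obtain ⟨y, hy⟩ : ∃ y : Fin n → ℝ, ∀ v, φ v = y ⬝ᵥ v :=
      ⟨fun i => φ (Pi.single i 1), fun v => by
        conv_lhs => rw [← Finset.univ_sum_single v]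
        rw [map_sum]
        refine Finset.sum_congr rfl fun i _ => ?_
        have : Pi.single i (v i) = v i • (Pi.single i 1 : Fin n → ℝ) := by
          rw [← Pi.single_smul]; simp
        rw [this, map_smul, smul_eq_mul, mul_comm]⟩
    let g : ℝ → Fin p → ℝ := fun s => y ᵥ* (NormedSpace.exp ((-s) • A) * B)
    have hg : Continuous g :=
      continuous_const.matrix_vecMul ((continuous_exp_neg_smul A).matrix_mul continuous_const)
    have hgg : Continuous fun s => g s ⬝ᵥ g s := hg.dotProduct hg
    have hint : ∫ s in (0 : ℝ)..1, g s ⬝ᵥ g s = 0 := by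
      have h1 : φ (∫ s in (0 : ℝ)..1, NormedSpace.exp ((-s) • A) *ᵥ (B *ᵥ g s)) = 0 :=
        hle ⟨g, hg, rfl⟩
      have h2 := ContinuousLinearMap.intervalIntegral_comp_comm
        (LinearMap.toContinuousLinearMap φ)
        ((hcont g hg).intervalIntegrable (μ := MeasureTheory.volume) 0 1)
      rw [LinearMap.coe_toContinuousLinearMap', h1] at h2
      refine Eq.trans (intervalIntegral.integral_congr fun s _ => ?_) h2
      simp only [hy, mulVec_mulVec, dotProduct_mulVec]
      rfl
    have hzero : ∀ s ∈ Set.Ioo (0 : ℝ) 1, g s = 0 := by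
      intro s hs
      by_contra hne
      have : 0 < ∫ s in (0 : ℝ)..1, g s ⬝ᵥ g s :=
        intervalIntegral.integral_pos one_pos hgg.continuousOn
          (fun x _ => Finset.sum_nonneg fun i _ => mul_self_nonneg _)
          ⟨s, Set.Ioo_subset_Icc_self hs, lt_of_le_of_ne
            (Finset.sum_nonneg fun i _ => mul_self_nonneg _)
            fun h0 => hne (dotProduct_self_eq_zero.1 h0.symm)⟩
      exact this.ne' hint
    have hz := h _ (vecMul_pow_eq_zero_of_exp hzero)
    have : y = 0 := by
      have := congrArg (fun z => z ᵥ* NormedSpace.exp ((1 / 2 : ℝ) • A)) hz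
      simpa only [vecMul_vecMul, exp_neg_smul_mul_exp_smul, vecMul_one, zero_vecMul] using this
    exact hφ (LinearMap.ext fun v => by simp [hy, this])
  intro x₀ x₁
  -- Variation of constants: `x(1) = e^A (x₀ + ∫₀¹ e^{-sA} B u)`, so the integral must equal `e^{-A}
  -- x₁ - x₀`.
  obtain ⟨u, hu, hux⟩ : NormedSpace.exp ((-1 : ℝ) • A) *ᵥ x₁ - x₀ ∈ W := hW ▸ Submodule.mem_top
  refine ⟨1, one_pos, u, fun t => NormedSpace.exp (t • A) *ᵥ
    (x₀ + ∫ s in (0 : ℝ)..t, NormedSpace.exp ((-s) • A) *ᵥ (B *ᵥ u s)), hu, fun t => ?_, ?_, ?_⟩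
  · have h1 := intervalIntegral.integral_hasDerivAt_right
      ((hcont u hu).intervalIntegrable (μ := MeasureTheory.volume) 0 t)
      ((hcont u hu).stronglyMeasurableAtFilter _ _) (hcont u hu).continuousAt
    have h2 := hasDerivAt_mulVec (hasDerivAt_exp_smul A t) (h1.const_add x₀)
    convert h2 using 1
    rw [mulVec_mulVec, mulVec_mulVec]
    congr 1
    have := exp_neg_smul_mul_exp_smul A (-t)
    rw [neg_neg] at this
    rw [this, one_mulVec]
  · simp
  · simp only [hux]
    have := exp_neg_smul_mul_exp_smul A (-1)
    rw [neg_neg] at this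
    rw [add_sub_cancel, mulVec_mulVec, this, one_mulVec]

end ODE

/-! ### Two necessary conditions for controllability. -/

/-- The quantity `y ⬝ᵥ x` is constant along trajectories, and a trajectory from `0` to `y` gives `y
⬝ᵥ y = 0`. -/
theorem Controllable.eq_zero_of_vecMul_eq_zero {n p : ℕ} {A : Matrix (Fin n) (Fin n) ℝ}
    {B : Matrix (Fin n) (Fin p) ℝ} (h : Controllable A B) {y : Fin n → ℝ} (hA : y ᵥ* A = 0)
    (hB : y ᵥ* B = 0) : y = 0 := by
  obtain ⟨T, -, u, x, -, hx, h0, h1⟩ := h 0 y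
  have hd : ∀ t, HasDerivAt (fun s => y ⬝ᵥ x s) 0 t := by
    intro t
    have := HasDerivAt.fun_sum (u := Finset.univ)
      (fun i _ => (hasDerivAt_pi.1 (hx t) i).const_mul (y i))
    refine this.congr_deriv ?_
    change y ⬝ᵥ (A *ᵥ x t + B *ᵥ u t) = 0
    rw [dotProduct_add, dotProduct_mulVec, dotProduct_mulVec, hA, hB]
    simp
  have hc := is_const_of_deriv_eq_zero (fun t => (hd t).differentiableAt) (fun t => (hd t).deriv) T 0
  simp only [h0, h1, dotProduct_zero] at hc
  exact dotProduct_self_eq_zero.1 hc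

/-- Without an entering edge the coordinates in `R` would solve an autonomous linear equation;
starting at `0` they would stay `0` by uniqueness. -/
theorem Controllable.exists_edge_into {n p : ℕ} {A : Matrix (Fin n) (Fin n) ℝ}
    {B : Matrix (Fin n) (Fin p) ℝ} (h : Controllable A B) {R : Set (Fin n)} (hR : R.Nonempty)
    (hB : ∀ w ∈ R, ∀ a, B w a = 0) : ∃ v ∉ R, ∃ w ∈ R, A w v ≠ 0 := by
  classical
  by_contra! hno
  obtain ⟨w₀, hw₀⟩ := hR
  obtain ⟨T, -, u, x, -, hx, h0, h1⟩ := h 0 (Pi.single w₀ 1)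
  let z : ℝ → Fin n → ℝ := fun t i => if i ∈ R then x t i else 0
  let C : Matrix (Fin n) (Fin n) ℝ := fun i j => if i ∈ R then A i j else 0
  have hz : ∀ t, HasDerivAt z (C *ᵥ z t) t := by
    intro t
    rw [hasDerivAt_pi]
    intro i
    by_cases hi : i ∈ R
    · have := hasDerivAt_pi.1 (hx t) i
      simp only [z, hi, if_true]
      convert this using 1
      simp only [mulVec, dotProduct, Pi.add_apply, C, hi, if_true, hB i hi, zero_mul,
        Finset.sum_const_zero, add_zero]
      refine Finset.sum_congr rfl fun j _ => ?_
      by_cases hj : j ∈ R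
      · simp [hj]
      · simp [hj, hno j hj i hi]
    · simp only [z, hi, if_false]
      convert hasDerivAt_const t (0 : ℝ) using 1
      simp [mulVec, dotProduct, C, hi]
  have hlip : LipschitzWith ‖LinearMap.toContinuousLinearMap (Matrix.mulVecLin C)‖₊
      (fun v : Fin n → ℝ => C *ᵥ v) :=
    (LinearMap.toContinuousLinearMap (Matrix.mulVecLin C)).lipschitz
  have := ODE_solution_unique_univ (v := fun _ v => C *ᵥ v) (s := fun _ => Set.univ) (f := z)
    (g := fun _ => 0) (t₀ := 0) (fun _ => hlip.lipschitzOnWith) (fun t => ⟨hz t, trivial⟩)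
    (fun t => ⟨by simpa using hasDerivAt_const t (0 : Fin n → ℝ), trivial⟩)
    (by ext i; simp [z, h0])
  have := congrFun (congrFun this T) w₀
  simp [z, hw₀, h1] at this

/-! ### Kalman's condition and its genericity. -/

section Kalman

variable {n p : ℕ}

/-- The Kalman controllability matrix `[B, AB, …, Aⁿ⁻¹B]`. -/
def kalmanMatrix {R : Type*} [CommRing R] (A : Matrix (Fin n) (Fin n) R)
    (B : Matrix (Fin n) (Fin p) R) : Matrix (Fin n) (Fin n × Fin p) R :=
  fun i q => (A ^ (q.1 : ℕ) * B) i q.2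

theorem kalmanMatrix_map {R S : Type*} [CommRing R] [CommRing S] (f : R →+* S)
    (A : Matrix (Fin n) (Fin n) R) (B : Matrix (Fin n) (Fin p) R) :
    (kalmanMatrix A B).map f = kalmanMatrix (A.map f) (B.map f) := by
  ext i q
  simp only [kalmanMatrix, map_apply]
  have h : (A ^ (q.1 : ℕ) * B).map f = (A.map f) ^ (q.1 : ℕ) * B.map f := by
    rw [Matrix.map_mul, Matrix.map_pow]
  exact congrFun (congrFun h i) q.2

theorem vecMul_pow_eq_zero_of_lt {A : Matrix (Fin n) (Fin n) ℝ} {B : Matrix (Fin n) (Fin p) ℝ}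
    {y : Fin n → ℝ} (h : ∀ k < n, y ᵥ* (A ^ k * B) = 0) (k : ℕ) : y ᵥ* (A ^ k * B) = 0 := by
  rcases Nat.eq_zero_or_pos n with rfl | hn
  · ext i
    simp [vecMul, dotProduct]
  have hdeg : (Polynomial.X ^ k %ₘ A.charpoly).natDegree < n := by
    have h1 := Polynomial.natDegree_modByMonic_lt (Polynomial.X ^ k) A.charpoly_monic
      (fun h1 => by
        have := A.charpoly_natDegree_eq_dim
        rw [h1] at this
        simp at this
        omega)
    simpa using h1
  rw [A.pow_eq_aeval_mod_charpoly, Polynomial.aeval_eq_sum_range' hdeg, Matrix.sum_mul,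
    vecMul_sum]
  refine Finset.sum_eq_zero fun i hi => ?_
  rw [smul_mul, vecMul_smul, h i (Finset.mem_range.1 hi), smul_zero]

/-- Over the reals the Gram determinant detects full row rank. It turns Kalman's condition into the
non-vanishing of a single polynomial in the entries. -/
theorem det_kalmanMatrix_mul_transpose_ne_zero_iff {A : Matrix (Fin n) (Fin n) ℝ}
    {B : Matrix (Fin n) (Fin p) ℝ} :
    (kalmanMatrix A B * (kalmanMatrix A B)ᵀ).det ≠ 0 ↔
      ∀ y : Fin n → ℝ, (∀ k : ℕ, y ᵥ* (A ^ k * B) = 0) → y = 0 := by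
  constructor
  · intro hdet y hy
    by_contra hne
    refine hdet (exists_vecMul_eq_zero_iff.1 ⟨y, hne, ?_⟩)
    have : y ᵥ* kalmanMatrix A B = 0 := by
      ext q
      exact congrFun (hy q.1) q.2
    rw [← vecMul_vecMul, this, zero_vecMul]
  · intro hobs hdet
    obtain ⟨y, hne, hy⟩ := exists_vecMul_eq_zero_iff.2 hdet
    have h1 : y ᵥ* kalmanMatrix A B = 0 := by
      have := (vecMul_self_mul_conjTranspose_eq_zero (kalmanMatrix A B) y).1 (by
        rwa [conjTranspose_eq_transpose_of_trivial])
      exact this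
    refine hne (hobs y (vecMul_pow_eq_zero_of_lt fun k hk => ?_))
    ext a
    exact congrFun h1 (⟨k, hk⟩, a)

/-- Along a line through an observable pair, all but finitely many pairs are observable. -/
theorem finite_setOf_not_observable {A M : Matrix (Fin n) (Fin n) ℝ} {B : Matrix (Fin n) (Fin p) ℝ}
    (hobs : ∀ y : Fin n → ℝ, (∀ k : ℕ, y ᵥ* (M ^ k * B) = 0) → y = 0) :
    {s : ℝ | ¬ ∀ y : Fin n → ℝ, (∀ k : ℕ, y ᵥ* ((A + s • (M - A)) ^ k * B) = 0) → y = 0}.Finite := by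
  -- The line through `A` and `M` with `s` as an indeterminate: its Gram determinant is a polynomial
  -- in `s`, nonzero because its value at `s = 1` belongs to `M`.
  let Q : Matrix (Fin n) (Fin n) (Polynomial ℝ) :=
    A.map Polynomial.C + (Polynomial.X : Polynomial ℝ) • (M - A).map Polynomial.C
  let K := kalmanMatrix Q (B.map Polynomial.C)
  have heval : ∀ s : ℝ, (K * Kᵀ).det.eval s =
      (kalmanMatrix (A + s • (M - A)) B * (kalmanMatrix (A + s • (M - A)) B)ᵀ).det := by
    intro s
    have hQ : Q.map (Polynomial.evalRingHom s) = A + s • (M - A) := by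
      ext i j
      simp [Q]
    have hB : (B.map Polynomial.C).map (Polynomial.evalRingHom s) = B := by
      ext i j
      simp
    have hK : K.map (Polynomial.evalRingHom s) = kalmanMatrix (A + s • (M - A)) B := by
      rw [kalmanMatrix_map, hQ, hB]
    rw [← Polynomial.coe_evalRingHom, RingHom.map_det, RingHom.mapMatrix_apply, Matrix.map_mul,
      transpose_map, hK]
  have hne : (K * Kᵀ).det ≠ 0 := by
    intro h0
    have h1 := heval 1
    rw [h0, Polynomial.eval_zero, one_smul, add_sub_cancel] at h1
    exact det_kalmanMatrix_mul_transpose_ne_zero_iff.2 hobs h1.symm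
  refine (Polynomial.finite_setOfPred_isRoot hne).subset fun s hs => ?_
  by_contra hroot
  refine hs (det_kalmanMatrix_mul_transpose_ne_zero_iff.1 ?_)
  rw [← heval]
  exact hroot

theorem controllable_smul_of_observable {A : Matrix (Fin n) (Fin n) ℝ}
    {B : Matrix (Fin n) (Fin p) ℝ}
    (hobs : ∀ y : Fin n → ℝ, (∀ k : ℕ, y ᵥ* (A ^ k * B) = 0) → y = 0) {c : ℝ} (hc : c ≠ 0) :
    Controllable (c • A) (c • B) := by
  refine controllable_of_observable fun y hy => hobs y fun k => ?_
  have := hy k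
  rw [smul_pow, Matrix.mul_smul, Matrix.smul_mul, smul_smul, vecMul_smul] at this
  exact (smul_eq_zero.1 this).resolve_left (mul_ne_zero hc (pow_ne_zero _ hc))

theorem SameStructure.smul {m n : ℕ} {M N : Matrix (Fin m) (Fin n) ℝ} (h : SameStructure M N)
    {c : ℝ} (hc : c ≠ 0) : SameStructure (c • M) N := fun i j => by
  rw [← h i j]
  simp [hc]

theorem SameStructure.eventually_normDistGT {m n : ℕ} {M N : Matrix (Fin m) (Fin n) ℝ}
    (h : SameStructure M N) (hN : N ≠ 0) (ε : ℝ) :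
    ∀ᶠ c : ℝ in Filter.atTop, NormDistGT (c • M) N ε := by
  obtain ⟨i, j, hij⟩ : ∃ i j, N i j ≠ 0 := by
    by_contra! h0
    exact hN (Matrix.ext h0)
  have hM : 0 < |M i j| := abs_pos.2 fun h0 => hij ((h i j).1 h0)
  have h1 : Filter.Tendsto (fun c : ℝ => c * |M i j| - |N i j|) Filter.atTop Filter.atTop :=
    Filter.tendsto_atTop_add_const_right _ _ (Filter.tendsto_id.atTop_mul_const hM)
  filter_upwards [h1.eventually_gt_atTop ε, Filter.eventually_ge_atTop 0] with c hc hc0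
  refine ⟨i, j, hc.trans_le ?_⟩
  have := abs_sub_abs_le_abs_sub (c * M i j) (N i j)
  rwa [abs_mul, abs_of_nonneg hc0] at this

/-- `M` may have more zeroes than `A`. For small `s ≠ 0` the matrix `A + s (M - A)` has the
structure of `A`, is close to `A`, and avoids the finitely many bad parameters. A large multiple of
the resulting pair is the distant one. -/
theorem structurallyControllable_of_observable {A M : Matrix (Fin n) (Fin n) ℝ}
    {B : Matrix (Fin n) (Fin p) ℝ} (hM : ∀ i j, M i j ≠ 0 → A i j ≠ 0)
    (hobs : ∀ y : Fin n → ℝ, (∀ k : ℕ, y ᵥ* (M ^ k * B) = 0) → y = 0) :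
    StructurallyControllable A B := by
  intro ε hε
  have hev : ∀ᶠ s : ℝ in nhdsWithin 0 {0}ᶜ,
      ∀ y : Fin n → ℝ, (∀ k : ℕ, y ᵥ* ((A + s • (M - A)) ^ k * B) = 0) → y = 0 := by
    -- The parameter `0` may itself be bad; with it removed, the finite bad set is closed and misses
    -- `0`.
    have hfin := (finite_setOf_not_observable (A := A) hobs).subset
      (Set.sdiff_subset (t := {(0 : ℝ)}))
    have := hfin.isClosed.isOpen_compl.mem_nhds (x := (0 : ℝ)) (by simp)
    filter_upwards [nhdsWithin_le_nhds this, self_mem_nhdsWithin] with s hs hs0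
    by_contra hcon
    exact hs ⟨hcon, hs0⟩
  have hcont : ∀ i j, Continuous fun s : ℝ => (A + s • (M - A)) i j := by
    intro i j
    simp only [Matrix.add_apply, Matrix.smul_apply, smul_eq_mul]
    fun_prop
  have hstr : ∀ᶠ s : ℝ in nhdsWithin 0 {0}ᶜ, SameStructure (A + s • (M - A)) A := by
    refine nhdsWithin_le_nhds ?_
    refine Filter.eventually_all.2 fun i => Filter.eventually_all.2 fun j => ?_
    by_cases hA : A i j = 0
    · have hM0 : M i j = 0 := by
        by_contra h0
        exact hM i j h0 hA
      exact Filter.Eventually.of_forall fun s => by simp [hA, hM0]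
    · have h0 : (A + (0 : ℝ) • (M - A)) i j ≠ 0 := by simpa using hA
      filter_upwards [(hcont i j).continuousAt.eventually_ne h0] with s hs
      simp only [hs, hA]
  have hnear : ∀ᶠ s : ℝ in nhdsWithin 0 {0}ᶜ, NormDistLT (A + s • (M - A)) A ε := by
    refine nhdsWithin_le_nhds ?_
    refine Filter.eventually_all.2 fun i => Filter.eventually_all.2 fun j => ?_
    have : Filter.Tendsto (fun s : ℝ => |(A + s • (M - A)) i j - A i j|) (nhds 0) (nhds 0) := by
      have := ((hcont i j).sub (continuous_const (y := A i j))).abs.tendsto 0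
      simpa using this
    exact this.eventually_lt_const hε
  obtain ⟨s, hs, hsA, hsε⟩ := (hev.and (hstr.and hnear)).exists
  have hBB : SameStructure B B := fun _ _ => Iff.rfl
  refine ⟨?_, A + s • (M - A), B, hsA, hBB, controllable_of_observable hs, hsε,
    fun i j => by simpa using hε⟩
  have hgt : ∀ {m n : ℕ} {M N : Matrix (Fin m) (Fin n) ℝ}, SameStructure M N →
      ∀ᶠ c : ℝ in Filter.atTop, N ≠ 0 → NormDistGT (c • M) N ε := fun {m n M N} h => by
    by_cases hN : N = 0
    · simp [hN]
    · filter_upwards [h.eventually_normDistGT hN ε] with c hc _ using hc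
  obtain ⟨c, hc0, hcA, hcB⟩ := ((Filter.eventually_gt_atTop (0 : ℝ)).and
    ((hgt hsA).and (hgt hBB))).exists
  exact ⟨c • (A + s • (M - A)), c • B, hsA.smul hc0.ne', hBB.smul hc0.ne',
    controllable_smul_of_observable hs hc0.ne', hcA, hcB⟩

end Kalman

/-! ### Paths and cycles as lists. -/

theorem pair_infix_cons_cons {V : Type*} {a b x y : V} {l : List V} :
    [a, b] <:+: x :: y :: l ↔ (a = x ∧ b = y) ∨ [a, b] <:+: y :: l := by
  rw [List.infix_cons_iff]
  simp [List.cons_prefix_cons]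

theorem eq_of_pair_infix {V : Type*} {a b b' : V} {l : List V} (hl : l.Nodup)
    (h : [a, b] <:+: l) (h' : [a, b'] <:+: l) : b = b' := by
  induction l with
  | nil => simp at h
  | cons x l ih =>
    cases l with
    | nil => exact absurd h.length_le (by simp)
    | cons y l =>
      have hx := (List.nodup_cons.1 hl).1
      rw [pair_infix_cons_cons] at h h'
      rcases h with ⟨rfl, rfl⟩ | h
      · rcases h' with ⟨-, rfl⟩ | h'
        · rfl
        · exact absurd (h'.subset (by simp)) hx
      · rcases h' with ⟨rfl, -⟩ | h'
        · exact absurd (h.subset (by simp)) hx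
        · exact ih (List.nodup_cons.1 hl).2 h h'

theorem forall_mem_of_forall_pair_infix {V : Type*} {P : V → Prop} {l : List V} {r : V}
    (hr : l.head? = some r) (hP : P r) (h : ∀ a b, [a, b] <:+: l → P a → P b) : ∀ x ∈ l, P x := by
  induction l generalizing r with
  | nil => simp
  | cons x l ih =>
    obtain rfl : x = r := by simpa using hr
    intro z hz
    rcases List.mem_cons.1 hz with rfl | hz
    · exact hP
    · cases l with
      | nil => simp at hz
      | cons y l =>
        exact ih rfl (h x y (pair_infix_cons_cons.2 (Or.inl ⟨rfl, rfl⟩)) hP)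
          (fun a b hab => h a b (pair_infix_cons_cons.2 (Or.inr hab))) z hz

theorem IsCycle.adj_formPerm {V : Type*} [DecidableEq V] {D : Digraph V} {c : List V}
    (hc : IsCycle D c) {x : V} (hx : x ∈ c) :
    D.Adj x (c.formPerm x) := by
  obtain ⟨⟨hne, hnd, hch⟩, hlast⟩ := hc
  obtain ⟨i, hi, rfl⟩ := List.getElem_of_mem hx
  rw [List.formPerm_apply_getElem _ hnd]
  by_cases h : i + 1 < c.length
  · simp only [Nat.mod_eq_of_lt h]
    exact List.isChain_iff_getElem.1 hch i h
  · have h1 : i + 1 = c.length := by omega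
    simp only [h1, Nat.mod_self]
    refine hlast _ ?_ _ ?_
    · rw [List.getLast?_eq_getElem?]
      simp [← h1]
    · rw [List.head?_eq_getElem?]
      simp

/-! ### The Hautus condition for a cactus driven at its root. -/

section Realization

variable {V : Type*} [Fintype V] [DecidableEq V]

/-- No eigenrow of `M` on `S` vanishes on all of `T`: the Popov–Belevitch–Hautus condition. -/
def HautusOn (M : Matrix V V ℂ) (S T : Set V) : Prop :=
  ∀ (μ : ℂ) (y : V → ℂ), (∀ x ∈ S, (y ᵥ* M) x = μ * y x) → (∀ r ∈ T, y r = 0) → ∀ x ∈ S, y x = 0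

/-- Otherwise the rows supported on `S` all of whose iterates vanish on `T` form a nonzero invariant
subspace, and over `ℂ` it contains an eigenrow. -/
theorem HautusOn.exists_vecMul_pow_ne_zero {M : Matrix V V ℂ} {S T : Set V} (h : HautusOn M S T)
    (hM : ∀ i j, M i j ≠ 0 → j ∈ S) {y : V → ℂ} (hy : y ≠ 0) (hyS : ∀ x ∉ S, y x = 0) :
    ∃ k : ℕ, ∃ r ∈ T, (y ᵥ* M ^ k) r ≠ 0 := by
  by_contra! hcon
  let N : Submodule ℂ (V → ℂ) :=
    { carrier := {z | (∀ x ∉ S, z x = 0) ∧ ∀ k : ℕ, ∀ r ∈ T, (z ᵥ* M ^ k) r = 0}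
      zero_mem' := by simp
      add_mem' := by
        rintro a b ⟨ha, ha'⟩ ⟨hb, hb'⟩
        refine ⟨fun x hx => by simp [ha x hx, hb x hx], fun k r hr => ?_⟩
        simp [add_vecMul, ha' k r hr, hb' k r hr]
      smul_mem' := by
        rintro c a ⟨ha, ha'⟩
        refine ⟨fun x hx => by simp [ha x hx], fun k r hr => ?_⟩
        simp [smul_vecMul, ha' k r hr] }
  have hinv : ∀ z ∈ N, M.vecMulLinear z ∈ N := by
    rintro z ⟨-, hz⟩
    refine ⟨fun x hx => ?_, fun k r hr => ?_⟩
    · refine Finset.sum_eq_zero fun i _ => ?_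
      have : M i x = 0 := by
        by_contra h0
        exact hx (hM i x h0)
      simp [this]
    · rw [vecMulLinear_apply, vecMul_vecMul, ← pow_succ']
      exact hz _ r hr
  have hyN : y ∈ N := ⟨hyS, hcon⟩
  have : Nontrivial N := ⟨⟨y, hyN⟩, 0, fun h0 => hy (congrArg Subtype.val h0)⟩
  obtain ⟨μ, hμ⟩ := Module.End.exists_eigenvalue (M.vecMulLinear.restrict hinv)
  obtain ⟨z, hz⟩ := hμ.exists_hasEigenvector
  have hzM : (z : V → ℂ) ᵥ* M = μ • (z : V → ℂ) := congrArg Subtype.val hz.apply_eq_smul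
  refine hz.2 (Subtype.ext (funext fun x => ?_))
  by_cases hx : x ∈ S
  · refine h μ z (fun x _ => by rw [hzM]; rfl) (fun r hr => ?_) x hx
    simpa using z.2.2 0 r hr
  · exact z.2.1 x hx

/-- For large `μ`, the row vector `e_v (μ - M)⁻¹` does not vanish at the root. -/
theorem HautusOn.exists_forall_resolvent {M : Matrix V V ℂ} {S : Set V} {r : V}
    (h : HautusOn M S {r}) (hM : ∀ i j, M i j ≠ 0 → i ∈ S ∧ j ∈ S) {v : V} (hv : v ∈ S) :
    ∃ R : ℝ, ∀ μ : ℂ, R < ‖μ‖ → ∀ (y : V → ℂ) (c : ℂ),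
      (∀ x ∈ S, (y ᵥ* M) x + c * (if x = v then 1 else 0) = μ * y x) → y r = 0 → c = 0 := by
  classical
  have hex : ∃ k : ℕ, (M ^ k) v r ≠ 0 := by
    obtain ⟨k, r', hr', hk⟩ := h.exists_vecMul_pow_ne_zero (fun i j hij => (hM i j hij).2)
      (y := Pi.single v 1) (fun h0 => by simpa using congrFun h0 v)
      (fun x hx => Pi.single_eq_of_ne (fun hxv : x = v => hx (hxv ▸ hv)) _)
    rw [Set.mem_singleton_iff.1 hr', single_one_vecMul] at hk
    exact ⟨k, hk⟩
  obtain ⟨k, hk, hmin⟩ : ∃ k : ℕ, (M ^ k) v r ≠ 0 ∧ ∀ j < k, (M ^ j) v r = 0 :=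
    ⟨Nat.find hex, Nat.find_spec hex, fun j hj => not_not.1 (Nat.find_min hex hj)⟩
  let F := LinearMap.toContinuousLinearMap M.vecMulLinear
  let G := LinearMap.toContinuousLinearMap (M ^ (k + 1)).vecMulLinear
  -- If `c ≠ 0`, the normalised row `z` satisfies `z M + e_v = μ z`, hence `(‖μ‖ - ‖F‖) ‖z‖ ≤ 1`.
  -- Minimality of `k` forces `(z M^(k+1)) r = -(M^k) v r`, hence `‖(M^k) v r‖ ≤ ‖G‖ ‖z‖`. The two
  -- bounds conflict beyond this radius.
  refine ⟨‖F‖ + ‖G‖ / ‖(M ^ k) v r‖, fun μ hμ y c hy hyr => ?_⟩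
  by_contra hc
  let z : V → ℂ := fun x => if x ∈ S then c⁻¹ * y x else 0
  have hcol : ∀ x ∉ S, ∀ i, M i x = 0 := fun x hx i => by
    by_contra h0
    exact hx (hM i x h0).2
  have hrow : ∀ i ∉ S, ∀ x, M i x = 0 := fun i hi x => by
    by_contra h0
    exact hi (hM i x h0).1
  have hz : z ᵥ* M + Pi.single v 1 = μ • z := by
    ext x
    have h1 : (z ᵥ* M) x = c⁻¹ * (y ᵥ* M) x := by
      simp only [vecMul, dotProduct, Finset.mul_sum]
      refine Finset.sum_congr rfl fun i _ => ?_
      by_cases hi : i ∈ S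
      · simp [z, hi, mul_assoc]
      · simp [hrow i hi]
    by_cases hx : x ∈ S
    · have := hy x hx
      simp only [Pi.add_apply, h1, Pi.smul_apply, z, hx, if_true, smul_eq_mul, Pi.single_apply]
      rw [mul_left_comm, ← this, mul_add, inv_mul_cancel_left₀ hc]
    · have hxv : x ≠ v := fun hxv => hx (hxv ▸ hv)
      simp [vecMul, dotProduct, hcol x hx, hxv, z, hx]
  have hstep : ∀ j : ℕ, (z ᵥ* M ^ (j + 1)) r + (M ^ j) v r = μ * (z ᵥ* M ^ j) r := by
    intro j
    have := congrArg (fun u => (u ᵥ* M ^ j) r) hz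
    simpa [add_vecMul, vecMul_vecMul, ← pow_succ', smul_vecMul] using this
  have hzero : ∀ j ≤ k, (z ᵥ* M ^ j) r = 0 := by
    intro j
    induction j with
    | zero => intro _; simp [z, hyr]
    | succ j ih =>
      intro hj
      have := hstep j
      rwa [ih (by omega), hmin j (by omega), add_zero, mul_zero] at this
  have hlast := hstep k
  rw [hzero k le_rfl, mul_zero, add_comm] at hlast
  have hG : ‖(M ^ k) v r‖ ≤ ‖G‖ * ‖z‖ := by
    rw [eq_neg_of_add_eq_zero_left hlast, norm_neg]
    exact (norm_le_pi_norm (z ᵥ* M ^ (k + 1)) r).trans (G.le_opNorm z)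
  have hF : ‖μ‖ * ‖z‖ ≤ ‖F‖ * ‖z‖ + 1 := by
    rw [← norm_smul, ← hz]
    refine (norm_add_le _ _).trans (add_le_add (F.le_opNorm z) ?_)
    simp [Pi.norm_single]
  have hpos : 0 < ‖(M ^ k) v r‖ := norm_pos_iff.2 hk
  have h1 : ‖G‖ < (‖μ‖ - ‖F‖) * ‖(M ^ k) v r‖ := by
    rw [← div_lt_iff₀ hpos]
    linarith
  have h2 : 0 ≤ ‖μ‖ - ‖F‖ := by
    have : 0 ≤ ‖G‖ / ‖(M ^ k) v r‖ := by positivity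
    linarith
  have h3 : (‖μ‖ - ‖F‖) * ‖(M ^ k) v r‖ ≤ ‖G‖ * ((‖μ‖ - ‖F‖) * ‖z‖) := by
    calc _ ≤ (‖μ‖ - ‖F‖) * (‖G‖ * ‖z‖) := mul_le_mul_of_nonneg_left hG h2
      _ = _ := by ring
  have h4 : ‖G‖ * ((‖μ‖ - ‖F‖) * ‖z‖) ≤ ‖G‖ * 1 :=
    mul_le_mul_of_nonneg_left (by linarith) (norm_nonneg _)
  linarith

/-- Some real matrix supported on the edges of `D` within `S` satisfies the Hautus condition with
respect to the single root `r`. -/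
def HasRealization (D : Digraph V) (S : Set V) (r : V) : Prop :=
  ∃ M : Matrix V V ℝ, (∀ i j, M i j ≠ 0 → i ∈ S ∧ j ∈ S ∧ D.Adj j i) ∧
    HautusOn (M.map Complex.ofReal) S {r}

/-- With unit weights the eigenrow equation at a vertex expresses the entry at its successor, so
zero propagates from the root. -/
theorem hasRealization_stem {D : Digraph V} {l : List V} {r : V} (hl : IsElementaryPath D l)
    (hr : l.head? = some r) : HasRealization D {x | x ∈ l} r := by
  classical
  refine ⟨Matrix.of fun i j => if [j, i] <:+: l then 1 else 0, fun i j hij => ?_, fun μ y hy hyr => ?_⟩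
  · have hji : [j, i] <:+: l := by
      by_contra h0
      simp [h0] at hij
    exact ⟨hji.subset (by simp), hji.subset (by simp), by simpa using hl.2.2.infix hji⟩
  · refine forall_mem_of_forall_pair_infix hr (hyr r rfl) fun a b hab hya => ?_
    have h1 := hy a (hab.subset (by simp))
    rw [hya, mul_zero] at h1
    rw [← h1, vecMul, dotProduct, Finset.sum_eq_single b]
    · simp [hab]
    · intro i _ hib
      have : ¬ [a, i] <:+: l := fun hai => hib (eq_of_pair_infix hl.2.1 hai hab)
      simp [this]
    · simp

/-- The cycle gets a common weight `a`. If `y w ≠ 0`, going round the cycle forces `‖μ‖ = a`; for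
`a` beyond the radius of `HautusOn.exists_forall_resolvent`, the cactus part of `y` could then not
vanish at the root. Once `y w = 0`, cycle and cactus decouple. -/
theorem hasRealization_bud {D : Digraph V} {S : Set V} {r v w : V} {c : List V}
    (hS : HasRealization D S r) (hc : IsCycle D c) (hdisj : ∀ x ∈ c, x ∉ S) (hv : v ∈ S)
    (hw : w ∈ c) (hvw : D.Adj v w) : HasRealization D (S ∪ {x | x ∈ c}) r := by
  classical
  obtain ⟨M, hM, hrig⟩ := hS
  obtain ⟨R, hR⟩ := hrig.exists_forall_resolvent (v := v)
    (fun i j hij => by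
      have := hM i j (fun h0 => hij (by simp [h0]))
      exact ⟨this.1, this.2.1⟩) hv
  obtain ⟨a, haR, ha⟩ : ∃ a : ℝ, R < a ∧ 0 < a :=
    ⟨max R 0 + 1, by linarith [le_max_left R 0], by linarith [le_max_right R 0]⟩
  let σ := c.formPerm
  have hσ : ∀ x ∈ c, σ x ∈ c := fun x hx => List.formPerm_apply_mem_of_mem hx
  let C : Matrix V V ℝ := fun i j => if j ∈ c ∧ i = σ j then a else 0
  refine ⟨M + C + Matrix.single w v 1, fun i j hij => ?_, fun μ y hy hyr => ?_⟩
  · by_cases h1 : M i j = 0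
    · by_cases h2 : C i j = 0
      · have h3 : w = i ∧ v = j := by
          by_contra h3
          exact hij (by simp [h1, h2, h3])
        obtain ⟨rfl, rfl⟩ := h3
        exact ⟨Or.inr hw, Or.inl hv, hvw⟩
      · have h3 : j ∈ c ∧ i = σ j := by
          by_contra h3
          simp [C, h3] at h2
        obtain ⟨hj, rfl⟩ := h3
        exact ⟨Or.inr (hσ j hj), Or.inr hj, hc.adj_formPerm hj⟩
    · obtain ⟨hi, hj, hadj⟩ := hM i j h1
      exact ⟨Or.inl hi, Or.inl hj, hadj⟩
  · have hsplit : ∀ x, (y ᵥ* (M + C + Matrix.single w v 1).map Complex.ofReal) x =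
        (y ᵥ* M.map Complex.ofReal) x + (if x ∈ c then a * y (σ x) else 0) +
          y w * (if x = v then 1 else 0) := by
      intro x
      simp only [vecMul, dotProduct, map_apply, Matrix.add_apply, Complex.ofReal_add, mul_add,
        Finset.sum_add_distrib]
      congr 2
      · simp only [C, ite_and]
        split_ifs with hx
        · rw [Finset.sum_eq_single (σ x)] <;> simp +contextual [mul_comm]
        · simp
      · rw [Finset.sum_eq_single w]
        · by_cases hxv : x = v
          · simp [hxv]
          · simp [hxv, Ne.symm hxv]
        · intro i _ hi
          simp [Ne.symm hi]
        · simp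
    have hcyc : ∀ x ∈ c, y (σ x) = μ / a * y x := by
      intro x hx
      have hxS := hdisj x hx
      have h1 := hy x (Or.inr hx)
      have h2 : (y ᵥ* M.map Complex.ofReal) x = 0 := by
        refine Finset.sum_eq_zero fun i _ => ?_
        have : M i x = 0 := by
          by_contra h0
          exact hxS (hM i x h0).2.1
        simp [this]
      have h3 : x ≠ v := fun h => hxS (h ▸ hv)
      rw [hsplit, h2, if_pos hx, if_neg h3, zero_add, mul_zero, add_zero] at h1
      have ha' : (a : ℂ) ≠ 0 := by exact_mod_cast ha.ne'
      field_simp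
      rw [← h1, mul_comm]
    have hpow : ∀ k : ℕ, (σ ^ k) w ∈ c ∧ y ((σ ^ k) w) = (μ / a) ^ k * y w := by
      intro k
      induction k with
      | zero => simpa using hw
      | succ k ih =>
        rw [pow_succ', Equiv.Perm.mul_apply]
        exact ⟨hσ _ ih.1, by rw [hcyc _ ih.1, ih.2, pow_succ', mul_assoc]⟩
    have hyS : ∀ x ∈ S, (y ᵥ* M.map Complex.ofReal) x + y w * (if x = v then 1 else 0) =
        μ * y x := by
      intro x hx
      have h1 := hy x (Or.inl hx)
      rwa [hsplit, if_neg (fun hxc => hdisj x hxc hx), add_zero] at h1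
    have hyw : y w = 0 := by
      by_contra hne
      have h1 := (hpow (orderOf σ)).2
      rw [pow_orderOf_eq_one, Equiv.Perm.one_apply] at h1
      have h2 : (μ / a) ^ orderOf σ = 1 := by
        have h3 : ((μ / a) ^ orderOf σ - 1) * y w = 0 := by linear_combination -h1
        exact sub_eq_zero.1 ((mul_eq_zero.1 h3).resolve_right hne)
      have h3 := Complex.norm_eq_one_of_pow_eq_one h2 (orderOf_pos σ).ne'
      rw [norm_div, Complex.norm_real, Real.norm_of_nonneg ha.le, div_eq_one_iff_eq ha.ne'] at h3
      exact hne (hR μ (h3 ▸ haR) y (y w) hyS (hyr r rfl))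
    rintro x (hx | hx)
    · refine hrig μ y (fun x hx => ?_) hyr x hx
      simpa [hyw] using hyS x hx
    · have hon : σ.IsCycleOn (c.toFinset : Set V) := by
        simpa using hc.1.2.1.isCycleOn_formPerm
      obtain ⟨k, -, rfl⟩ := hon.exists_pow_eq (by simpa using hw) (by simpa using hx)
      rw [(hpow k).2, hyw, mul_zero]

theorem IsCactus.hasRealization {D : Digraph V} {S : Set V} {E : Set (V × V)} {r t : V}
    (h : IsCactus D S E r t) : HasRealization D S r := by
  induction h with
  | stem l r t hl hr ht => exact hasRealization_stem hl hr
  | bud S E r t c v w hS hc hdisj hv hvt hw hvw ih =>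
    exact hasRealization_bud ih hc hdisj hv hw hvw

end Realization

/-! ### From spanning cacti to dedicated inputs. -/

/-- As the vertex sets are disjoint, the sum of the realizations is block diagonal and an eigenrow
restricts to each block. -/
theorem exists_matrix_hautusOn_of_cacti {V ι : Type*} [Fintype V] [Fintype ι] {D : Digraph V}
    {S : ι → Set V}
    {r : ι → V} (h : ∀ a, HasRealization D (S a) (r a))
    (hdisj : ∀ a b, a ≠ b → Disjoint (S a) (S b)) (hcov : ⋃ a, S a = Set.univ) :
    ∃ M : Matrix V V ℝ, (∀ i j, M i j ≠ 0 → D.Adj j i) ∧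
      HautusOn (M.map Complex.ofReal) Set.univ (Set.range r) := by
  choose M hM hrig using h
  refine ⟨∑ a, M a, fun i j hij => ?_, fun μ y hy hyr x _ => ?_⟩
  · obtain ⟨a, -, ha⟩ := Finset.exists_ne_zero_of_sum_ne_zero
      (by simpa [Matrix.sum_apply] using hij : ∑ a, M a i j ≠ 0)
    exact (hM a i j ha).2.2
  · obtain ⟨a, hxa⟩ := Set.mem_iUnion.1 (hcov ▸ Set.mem_univ x : x ∈ ⋃ a, S a)
    refine hrig a μ y (fun z hz => ?_) (fun r' hr' => hyr r' ⟨a, hr'.symm⟩) x hxa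
    rw [← hy z trivial]
    refine Finset.sum_congr rfl fun i _ => ?_
    simp only [map_apply, Matrix.sum_apply]
    rw [Finset.sum_eq_single a]
    · intro b _ hba
      by_contra h0
      exact Set.disjoint_left.1 (hdisj b a hba) (hM b i z h0).2.1 hz
    · simp

/-- The input matrix whose column `a` is the standard basis vector at `r a`. -/
def dedicatedInputs {n p : ℕ} (r : Fin p → Fin n) : Matrix (Fin n) (Fin p) ℝ :=
  fun i a => if i = r a then 1 else 0

theorem dedicated_dedicatedInputs {n p : ℕ} (r : Fin p → Fin n) :
    Dedicated (dedicatedInputs r) := fun a => by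
  refine ⟨r a, by simp [dedicatedInputs], fun i hi => ?_⟩
  by_contra hne
  simp [dedicatedInputs, hne] at hi

theorem structurallyControllable_of_spannedByCacti {n k : ℕ} {A : Matrix (Fin n) (Fin n) ℝ}
    (h : SpannedByCacti (stateDigraph A) k) :
    ∃ B : Matrix (Fin n) (Fin k) ℝ, Dedicated B ∧ StructurallyControllable A B := by
  obtain ⟨S, E, r, t, hcact, hdisj, hcov⟩ := h
  obtain ⟨M, hM, hrig⟩ :=
    exists_matrix_hautusOn_of_cacti (fun a => (hcact a).hasRealization) hdisj hcov
  refine ⟨dedicatedInputs r, dedicated_dedicatedInputs r,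
    structurallyControllable_of_observable hM fun y hy => ?_⟩
  by_contra hne
  obtain ⟨k, _, ⟨a, rfl⟩, hk⟩ := hrig.exists_vecMul_pow_ne_zero (fun _ _ _ => trivial)
    (y := fun i => (y i : ℂ))
    (fun h0 => hne (funext fun i => by simpa using congrFun h0 i)) (fun x hx => absurd trivial hx)
  refine hk ?_
  have h1 : (y ᵥ* M ^ k) (r a) = 0 := by
    have := congrFun (hy k) a
    rw [← vecMul_vecMul] at this
    simpa [vecMul, dotProduct, dedicatedInputs] using this
  have h2 : M.map Complex.ofReal ^ k = (M ^ k).map Complex.ofReal :=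
    (Matrix.map_pow M Complex.ofRealHom k).symm
  rw [h2]
  have h3 := congrArg Complex.ofReal h1
  simpa [vecMul, dotProduct] using h3

/-! ### Growing spanning cacti from distinct predecessors. -/

theorem IsElementaryPath.append {V : Type*} {D : Digraph V} {l l' : List V}
    (hl : IsElementaryPath D l) (hl' : IsElementaryPath D l') (hdisj : ∀ x ∈ l', x ∉ l)
    (hadj : ∀ a ∈ l.getLast?, ∀ b ∈ l'.head?, D.Adj a b) : IsElementaryPath D (l ++ l') :=
  ⟨List.append_ne_nil_of_left_ne_nil hl.1 _,
    List.nodup_append'.2 ⟨hl.2.1, hl'.2.1, fun x hx hx' => hdisj x hx' hx⟩,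
    List.isChain_append.2 ⟨hl.2.2, hl'.2.2, hadj⟩⟩

/-- The stem of a cactus can be prolonged beyond its tip by a path disjoint from the cactus. -/
theorem IsCactus.extend {V : Type*} {D : Digraph V} {S : Set V} {E : Set (V × V)} {r t : V}
    (h : IsCactus D S E r t) {l : List V} (hl : IsElementaryPath D l) (hdisj : ∀ x ∈ l, x ∉ S)
    (hadj : ∀ b ∈ l.head?, D.Adj t b) {t' : V} (ht' : l.getLast? = some t') :
    ∃ E', IsCactus D (S ∪ {x | x ∈ l}) E' r t' := by
  induction h with
  | stem m r t hm hr ht =>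
    have hpath : IsElementaryPath D (m ++ l) := hm.append hl hdisj fun a ha b hb => by
      obtain rfl : t = a := by simpa [ht] using ha
      exact hadj b hb
    have := IsCactus.stem (D := D) (m ++ l) r t' hpath (by simp [hr]) (by simp [ht'])
    refine ⟨_, (?_ : {x | x ∈ m ++ l} = {x | x ∈ m} ∪ {x | x ∈ l}) ▸ this⟩
    ext x
    simp
  | bud S E r t c v w hS hc hcS hv hvt hw hvw ih =>
    obtain ⟨E', hE'⟩ := ih (fun x hx hxS => hdisj x hx (Or.inl hxS)) hadj
    have ht'l : t' ∈ l := List.mem_of_getLast? ht'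
    -- The bud may stay attached at `v`, since the new tip lies outside `S` and so differs from `v`.
    have := IsCactus.bud _ E' r t' c v w hE' hc
      (fun x hx hxS => hxS.elim (hcS x hx) fun hxl => hdisj x hxl (Or.inr hx)) (Or.inl hv)
      (fun hvt' => hdisj t' ht'l (Or.inl (hvt' ▸ hv))) hw hvw
    exact ⟨_, Set.union_right_comm S {x | x ∈ l} {x | x ∈ c} ▸ this⟩

/-- An injective self-map of a finite set `R`, followed backwards from `w`, runs through a cycle. -/
theorem exists_backward_cycle {V : Type*} [Finite V] {R : Set V} {pred : V → V}
    (hmaps : ∀ x ∈ R, pred x ∈ R) (hinj : Set.InjOn pred R) {w : V} (hw : w ∈ R) :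
    ∃ c : List V, c.head? = some w ∧ c.Nodup ∧ (∀ x ∈ c, x ∈ R) ∧
      c.IsChain (fun a b => b ∈ R ∧ pred b = a) ∧ c.getLast? = some (pred w) ∧
      ∀ x ∈ R, pred x ∈ c → x ∈ c := by
  classical
  -- Extended by the identity, `pred` becomes a permutation; the orbit of `w` under its inverse `σ`
  -- lists the cycle in the direction of the edges.
  let h : V → V := fun x => if x ∈ R then pred x else x
  have hh : Function.Injective h := by
    intro x y hxy
    by_cases hx : x ∈ R <;> by_cases hy : y ∈ R <;> simp only [h, hx, hy, if_true, if_false] at hxy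
    · exact hinj hx hy hxy
    · exact absurd (hxy ▸ hmaps x hx) hy
    · exact absurd (hxy ▸ hmaps y hy) hx
    · exact hxy
  let σ := (Equiv.ofBijective h (Finite.injective_iff_bijective.1 hh)).symm
  have hσh : ∀ x, σ (h x) = x := fun x => Equiv.ofBijective_symm_apply_apply h _ x
  have hhσ : ∀ x, h (σ x) = x := fun x => Equiv.ofBijective_apply_symm_apply h _ x
  have hσpred : ∀ x ∈ R, σ (pred x) = x := fun x hx => by simpa [h, hx] using hσh x
  have hσR : ∀ x ∈ R, σ x ∈ R ∧ pred (σ x) = x := by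
    intro x hx
    have h1 := hhσ x
    by_cases h2 : σ x ∈ R
    · exact ⟨h2, by simpa [h, h2] using h1⟩
    · simp only [h, h2, if_false] at h1
      exact absurd (by rwa [h1]) h2
  have hiter : ∀ k : ℕ, σ^[k] w ∈ R := by
    intro k
    induction k with
    | zero => exact hw
    | succ k ih => rw [Function.iterate_succ_apply']; exact (hσR _ ih).1
  obtain ⟨m, hm⟩ : ∃ m, Function.minimalPeriod σ w = m + 1 :=
    Nat.exists_eq_succ_of_ne_zero
      (Function.minimalPeriod_pos_of_mem_periodicPts
        (σ.injective.mem_periodicPts w)).ne'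
  have hper : σ^[m + 1] w = w := hm ▸ Function.iterate_minimalPeriod
  have hmem : ∀ x, x ∈ (List.range (m + 1)).map (fun k => σ^[k] w) ↔ ∃ k < m + 1, σ^[k] w = x :=
    fun x => by simp only [List.mem_map, List.mem_range]
  refine ⟨(List.range (m + 1)).map fun k => σ^[k] w, by simp, ?_, ?_, ?_, ?_, ?_⟩
  · refine List.nodup_range.map_on fun i hi j hj hij => ?_
    rw [List.mem_range, ← hm] at hi hj
    exact Function.iterate_injOn_Iio_minimalPeriod hi hj hij
  · intro x hx
    obtain ⟨k, -, rfl⟩ := (hmem x).1 hx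
    exact hiter k
  · rw [List.isChain_map, List.isChain_iff_getElem]
    intro i hi
    simp only [List.getElem_range, Function.iterate_succ_apply']
    exact hσR _ (hiter i)
  · have : pred w = σ^[m] w := by
      have h1 := (hσR _ (hiter m)).2
      rwa [← Function.iterate_succ_apply' σ, hper] at h1
    simp [List.range_succ, this]
  · intro x hx hpx
    obtain ⟨k, hk, hkx⟩ := (hmem _).1 hpx
    have hx' : σ^[k + 1] w = x := by
      rw [Function.iterate_succ_apply', hkx, hσpred x hx]
    rw [hmem]
    by_cases hkm : k + 1 < m + 1
    · exact ⟨k + 1, hkm, hx'⟩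
    · obtain rfl : k = m := by omega
      exact ⟨0, by omega, by rw [← hx', hper]; rfl⟩

theorem pairwise_disjoint_update_union {V ι : Type*} [DecidableEq ι] {S : ι → Set V} {C : Set V}
    (hS : ∀ a b, a ≠ b → Disjoint (S a) (S b)) (hC : ∀ x ∈ C, x ∉ ⋃ a, S a) (a₀ : ι) (a b : ι)
    (hab : a ≠ b) : Disjoint (Function.update S a₀ (S a₀ ∪ C) a)
      (Function.update S a₀ (S a₀ ∪ C) b) := by
  have hCS : ∀ b, Disjoint C (S b) := fun b =>
    Set.disjoint_left.2 fun x hx hxb => hC x hx (Set.mem_iUnion.2 ⟨b, hxb⟩)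
  rcases eq_or_ne a a₀ with rfl | ha
  · rw [Function.update_self, Function.update_of_ne hab.symm, Set.disjoint_union_left]
    exact ⟨hS _ _ hab, hCS b⟩
  · rcases eq_or_ne b a₀ with rfl | hb
    · rw [Function.update_self, Function.update_of_ne hab, Set.disjoint_union_right]
      exact ⟨hS _ _ hab, (hCS a).symm⟩
    · rw [Function.update_of_ne ha, Function.update_of_ne hb]
      exact hS _ _ hab

theorem iUnion_update_union {V ι : Type*} [DecidableEq ι] (S : ι → Set V) (C : Set V) (a₀ : ι) :
    ⋃ a, Function.update S a₀ (S a₀ ∪ C) a = (⋃ a, S a) ∪ C := by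
  ext x
  simp only [Set.mem_iUnion, Set.mem_union]
  constructor
  · rintro ⟨a, ha⟩
    rcases eq_or_ne a a₀ with rfl | h
    · rw [Function.update_self] at ha
      exact ha.imp_left fun hx => ⟨a, hx⟩
    · rw [Function.update_of_ne h] at ha
      exact Or.inl ⟨a, ha⟩
  · rintro (⟨a, ha⟩ | hx)
    · rcases eq_or_ne a a₀ with rfl | h
      · exact ⟨a, by rw [Function.update_self]; exact Or.inl ha⟩
      · exact ⟨a, by rwa [Function.update_of_ne h]⟩
    · exact ⟨a₀, by rw [Function.update_self]; exact Or.inr hx⟩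

/-- A family of disjoint cacti that satisfies the invariant of the construction (the predecessor of
an uncovered vertex is uncovered or a tip) and does not yet cover `V` can be enlarged. -/
theorem exists_larger_cactus {V ι : Type*} [Finite V] [DecidableEq ι] {D : Digraph V} {I : Set V}
    {pred : V → V} (hadj : ∀ w ∉ I, D.Adj (pred w) w) (hinj : Set.InjOn pred Iᶜ)
    (hreach : ∀ R : Set V, R.Nonempty → (∀ w ∈ R, w ∉ I) → ∃ v ∉ R, ∃ w ∈ R, D.Adj v w)
    {S : ι → Set V} {r t : ι → V} (hcact : ∀ a, ∃ E, IsCactus D (S a) E (r a) (t a))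
    (hI : I ⊆ ⋃ a, S a) (hinv : ∀ w ∉ ⋃ a, S a, pred w ∉ ⋃ a, S a ∨ ∃ a, pred w = t a)
    (hne : ⋃ a, S a ≠ Set.univ) :
    ∃ (a : ι) (C : Set V) (τ : V), C.Nonempty ∧ (∀ x ∈ C, x ∉ ⋃ a, S a) ∧
      (∃ E, IsCactus D (S a ∪ C) E (r a) τ) ∧
      ∀ w ∉ (⋃ a, S a) ∪ C, pred w ∉ (⋃ a, S a) ∪ C ∨ ∃ b, pred w = Function.update t a τ b := by
  -- Either an uncovered vertex follows a tip and prolongs that stem, or the uncovered set is closed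
  -- under `pred` and splits into cycles, one of which is entered from a cactus.
  by_cases htip : ∃ w ∉ ⋃ a, S a, ∃ a, pred w = t a
  · obtain ⟨w, hw, a, hwa⟩ := htip
    obtain ⟨E, hE⟩ := hcact a
    obtain ⟨E', hE'⟩ := hE.extend (l := [w]) (t' := w) ⟨by simp, by simp, by simp⟩
      (fun x hx hxS => hw (Set.mem_iUnion.2 ⟨a, List.mem_singleton.1 hx ▸ hxS⟩))
      (fun b hb => by
        obtain rfl : w = b := by simpa using hb
        exact hwa ▸ hadj w fun hwI => hw (hI hwI)) (by simp)
    refine ⟨a, {x | x ∈ [w]}, w, ⟨w, by simp⟩, fun x hx => List.mem_singleton.1 hx ▸ hw,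
      ⟨E', hE'⟩, fun z hz => ?_⟩
    have hzS : z ∉ ⋃ a, S a := fun h => hz (Or.inl h)
    have hzw : z ≠ w := fun h => hz (Or.inr (by simp [h]))
    by_cases hpz : pred z = w
    · exact Or.inr ⟨a, by rw [Function.update_self, hpz]⟩
    · rcases hinv z hzS with h | ⟨b, hb⟩
      · exact Or.inl fun h' => h'.elim h fun h'' => hpz (List.mem_singleton.1 h'')
      -- The old tip `t a` is the predecessor of `w` only, so replacing it by `w` does no harm to
      -- other vertices.
      · have hba : b ≠ a := fun hba => hzw <| hinj (fun h => hzS (hI h)) (fun h => hw (hI h))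
          (by rw [hb, hwa, hba])
        exact Or.inr ⟨b, by rw [Function.update_of_ne hba, hb]⟩
  · have hclosed : ∀ w ∈ (⋃ a, S a)ᶜ, pred w ∈ (⋃ a, S a)ᶜ := fun w hw =>
      (hinv w hw).resolve_right fun h => htip ⟨w, hw, h⟩
    have hRI : ∀ w ∈ (⋃ a, S a)ᶜ, w ∉ I := fun w hw h => hw (hI h)
    obtain ⟨v, hv, w, hw, hvw⟩ := hreach (⋃ a, S a)ᶜ (Set.nonempty_compl.2 hne) hRI
    obtain ⟨a, hva⟩ := Set.mem_iUnion.1 (not_not.1 hv)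
    obtain ⟨c, hhead, hnd, hcR, hch, hlast, hback⟩ :=
      exists_backward_cycle hclosed (hinj.mono hRI) hw
    have hpath : IsElementaryPath D c := ⟨by rintro rfl; simp at hhead, hnd,
      hch.imp (S := D.Adj) fun x y (hxy : y ∈ (⋃ a, S a)ᶜ ∧ pred y = x) =>
        hxy.2 ▸ hadj y (hRI y hxy.1)⟩
    have hwc : w ∈ c := List.mem_of_head? hhead
    have hcS : ∀ x ∈ c, x ∉ S a := fun x hx hxS => hcR x hx (Set.mem_iUnion.2 ⟨a, hxS⟩)
    obtain ⟨E, hE⟩ := hcact a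
    -- No bud may hang on the tip. If the entering edge starts there, the cycle is cut open before
    -- `w` and prolongs the stem up to `pred w`.
    obtain ⟨τ, hτ⟩ : ∃ τ, ∃ E, IsCactus D (S a ∪ {x | x ∈ c}) E (r a) τ := by
      by_cases hvt : v = t a
      · exact ⟨_, hE.extend hpath hcS
          (fun b hb => by
            obtain rfl : w = b := by simpa [hhead] using hb
            exact hvt ▸ hvw) hlast⟩
      · refine ⟨t a, _, hE.bud _ _ _ _ c v w ⟨hpath, fun x hx y hy => ?_⟩ hcS hva hvt hwc hvw⟩
        obtain rfl : pred w = x := by simpa [hlast] using hx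
        obtain rfl : w = y := by simpa [hhead] using hy
        exact hadj w (hRI w hw)
    refine ⟨a, {x | x ∈ c}, τ, ⟨w, hwc⟩, hcR, hτ, fun z hz => Or.inl fun hpz => ?_⟩
    have hzS : z ∈ (⋃ a, S a)ᶜ := fun h => hz (Or.inl h)
    exact hpz.elim (hclosed z hzS) fun h => hz (Or.inr (hback z hzS h))

/-- Recursion on the number of uncovered vertices; the roots never change. -/
theorem exists_cacti_of_invariant {V ι : Type*} [Finite V] {D : Digraph V} {I : Set V}
    {pred : V → V} (hadj : ∀ w ∉ I, D.Adj (pred w) w) (hinj : Set.InjOn pred Iᶜ)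
    (hreach : ∀ R : Set V, R.Nonempty → (∀ w ∈ R, w ∉ I) → ∃ v ∉ R, ∃ w ∈ R, D.Adj v w)
    (S : ι → Set V) (r t : ι → V) (hcact : ∀ a, ∃ E, IsCactus D (S a) E (r a) (t a))
    (hdisj : ∀ a b, a ≠ b → Disjoint (S a) (S b)) (hI : I ⊆ ⋃ a, S a)
    (hinv : ∀ w ∉ ⋃ a, S a, pred w ∉ ⋃ a, S a ∨ ∃ a, pred w = t a) :
    ∃ (S : ι → Set V) (t : ι → V), (∀ a, ∃ E, IsCactus D (S a) E (r a) (t a)) ∧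
      (∀ a b, a ≠ b → Disjoint (S a) (S b)) ∧ ⋃ a, S a = Set.univ := by
  classical
  by_cases hne : ⋃ a, S a = Set.univ
  · exact ⟨S, t, hcact, hdisj, hne⟩
  obtain ⟨a, C, τ, ⟨x, hx⟩, hC, hτ, hinv'⟩ :=
    exists_larger_cactus hadj hinj hreach hcact hI hinv hne
  have hlt : ((⋃ b, Function.update S a (S a ∪ C) b)ᶜ).ncard < ((⋃ b, S b)ᶜ).ncard := by
    rw [iUnion_update_union]
    refine Set.ncard_lt_ncard ⟨Set.compl_subset_compl.2 Set.subset_union_left, fun h => ?_⟩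
    exact h (hC x hx) (Or.inr hx)
  refine exists_cacti_of_invariant hadj hinj hreach (Function.update S a (S a ∪ C)) r
    (Function.update t a τ) (fun b => ?_) (pairwise_disjoint_update_union hdisj hC a) ?_ ?_
  · rcases eq_or_ne b a with rfl | hb
    · simpa using hτ
    · simpa [hb] using hcact b
  · rw [iUnion_update_union]
    exact hI.trans Set.subset_union_left
  · rw [iUnion_update_union]
    exact hinv'
termination_by ((⋃ a, S a)ᶜ).ncard
decreasing_by simpa only [Set.compl_iUnion] using hlt

/-- A digraph in which the vertices outside `I` have pairwise distinct predecessors and are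
reachable from `I` is spanned by disjoint cacti, one for each vertex of `I`. -/
theorem spannedByCacti_of_matching {V : Type*} [Finite V] {D : Digraph V} {I : Set V}
    {pred : V → V} (hadj : ∀ w ∉ I, D.Adj (pred w) w) (hinj : Set.InjOn pred Iᶜ)
    (hreach : ∀ R : Set V, R.Nonempty → (∀ w ∈ R, w ∉ I) → ∃ v ∉ R, ∃ w ∈ R, D.Adj v w) :
    SpannedByCacti D I.ncard := by
  have e : Fin I.ncard ≃ I := (Finite.equivFinOfCardEq (Nat.card_coe_set_eq I)).symm
  have hU : ⋃ a, ({x | x ∈ [(e a : V)]} : Set V) = I := by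
    ext x
    simp only [List.mem_singleton, Set.mem_iUnion, Set.mem_ofPred_eq]
    exact ⟨fun ⟨a, ha⟩ => ha ▸ (e a).2, fun hx => ⟨e.symm ⟨x, hx⟩, by simp⟩⟩
  -- Starting from single-vertex stems, every covered vertex is a tip, so the invariant holds.
  obtain ⟨S, t, hcact, hdisj, hcov⟩ := exists_cacti_of_invariant hadj hinj hreach
    (fun a => {x | x ∈ [(e a : V)]}) (fun a => (e a : V)) (fun a => (e a : V))
    (fun a => ⟨_, IsCactus.stem [(e a : V)] _ _ ⟨by simp, by simp, by simp⟩ rfl rfl⟩)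
    (fun a b hab => by simpa [Subtype.ext_iff] using (fun h => hab (e.injective (Subtype.ext h))))
    hU.ge
    (fun w _ => by
      by_cases h : pred w ∈ I
      · exact Or.inr ⟨e.symm ⟨_, h⟩, by simp⟩
      · exact Or.inl (by rwa [hU]))
  choose E hE using hcact
  exact ⟨S, E, _, t, hE, hdisj, hcov⟩

/-! ### From dedicated inputs to spanning cacti. -/

/-- Linearly independent rows have a system of distinct representatives in their supports. -/
theorem exists_injOn_of_rows_independent {n : ℕ} {A : Matrix (Fin n) (Fin n) ℝ} {I : Set (Fin n)}
    (h : ∀ y : Fin n → ℝ, (∀ i ∈ I, y i = 0) → Matrix.vecMul y A = 0 → y = 0) :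
    ∃ pred : Fin n → Fin n, (∀ w ∉ I, A w (pred w) ≠ 0) ∧ Set.InjOn pred Iᶜ := by
  classical
  -- Hall's condition: the rows in `s` remain independent when cut down to the columns `N` where
  -- they live, so `s` has at most as many elements as `N`.
  obtain ⟨f, hf, hfA⟩ := (Finset.all_card_le_biUnion_card_iff_exists_injective
    (fun i : (Iᶜ : Set (Fin n)) => Finset.univ.filter fun j => A i j ≠ 0)).1 (by
      intro s
      let N := s.biUnion fun i : (Iᶜ : Set (Fin n)) => Finset.univ.filter fun j => A i j ≠ 0
      have hli : LinearIndependent ℝ fun i : s => fun j : N => A (i : (Iᶜ : Set (Fin n))) j := by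
        rw [Fintype.linearIndependent_iff]
        intro g hg
        let y : Fin n → ℝ := fun i =>
          if hi : ∃ hi : i ∈ Iᶜ, (⟨i, hi⟩ : (Iᶜ : Set (Fin n))) ∈ s then g ⟨⟨i, hi.1⟩, hi.2⟩ else 0
        have hyg : ∀ i : s, y i = g i := fun i => by
          have : ∃ hi : ((i : (Iᶜ : Set (Fin n))) : Fin n) ∈ Iᶜ,
              (⟨i, hi⟩ : (Iᶜ : Set (Fin n))) ∈ s := ⟨i.1.2, i.2⟩
          simp only [y, dif_pos this]
        have hsum : ∀ j, Matrix.vecMul y A j = ∑ i : s, g i * A (i : (Iᶜ : Set (Fin n))) j := by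
          intro j
          have hinj : Function.Injective fun i : s => ((i : (Iᶜ : Set (Fin n))) : Fin n) :=
            Subtype.val_injective.comp Subtype.val_injective
          simp only [Matrix.vecMul, dotProduct]
          rw [← Finset.sum_subset (Finset.subset_univ
            (Finset.univ.map ⟨fun i : s => ((i : (Iᶜ : Set (Fin n))) : Fin n), hinj⟩)),
            Finset.sum_map]
          · simp [hyg]
          · intro i _ hi
            have : ¬ ∃ hi : i ∈ Iᶜ, (⟨i, hi⟩ : (Iᶜ : Set (Fin n))) ∈ s := by
              rintro ⟨h1, h2⟩
              exact hi (Finset.mem_map.2 ⟨⟨⟨i, h1⟩, h2⟩, Finset.mem_univ _, rfl⟩)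
            simp only [y, dif_neg this, zero_mul]
        have hy : y = 0 := by
          refine h y (fun i hi => ?_) (funext fun j => ?_)
          · exact dif_neg fun h' => h'.1 hi
          · rw [hsum]
            by_cases hj : j ∈ N
            · simpa using congrFun hg ⟨j, hj⟩
            · refine Finset.sum_eq_zero fun i _ => ?_
              have : A (i : (Iᶜ : Set (Fin n))) j = 0 := by
                by_contra h0
                exact hj (Finset.mem_biUnion.2 ⟨i, i.2, by simpa using h0⟩)
              simp [this]
        intro i
        rw [← hyg, hy]
        rfl
      simpa using hli.fintype_card_le_finrank)
  refine ⟨fun i => if hi : i ∈ Iᶜ then f ⟨i, hi⟩ else i, fun w hw => ?_, fun x hx y hy hxy => ?_⟩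
  · have hw' : w ∈ Iᶜ := hw
    have := hfA ⟨w, hw'⟩
    simp only [dif_pos hw']
    simpa using this
  · simp only [dif_pos hx, dif_pos hy] at hxy
    exact congrArg Subtype.val (hf hxy)

/-- The cacti are rooted at the states that carry an input. Two columns may share a state, whence `k
≤ p` and not equality. -/
theorem exists_spannedByCacti_le {n p : ℕ} {A : Matrix (Fin n) (Fin n) ℝ}
    {B : Matrix (Fin n) (Fin p) ℝ} (hB : Dedicated B) (h : StructurallyControllable A B) :
    ∃ k ≤ p, SpannedByCacti (stateDigraph A) k := by
  obtain ⟨-, A', B', hA', hB', hctrl, -, -⟩ := h 1 one_pos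
  let I : Set (Fin n) := {i | ∃ a, B i a ≠ 0}
  have hIB : ∀ i ∉ I, ∀ a, B' i a = 0 := fun i hi a => by
    by_contra h0
    exact hi ⟨a, fun h1 => h0 ((hB' i a).2 h1)⟩
  have hAdj : ∀ i j, A' i j ≠ 0 → (stateDigraph A).Adj j i := fun i j hij h0 =>
    hij ((hA' i j).2 h0)
  obtain ⟨pred, hpred, hinj⟩ := exists_injOn_of_rows_independent (A := A') (I := I)
    fun y hyI hyA => hctrl.eq_zero_of_vecMul_eq_zero hyA <| funext fun a => by
      change ∑ i, y i * B' i a = 0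
      refine Finset.sum_eq_zero fun i _ => ?_
      by_cases hi : i ∈ I
      · simp [hyI i hi]
      · simp [hIB i hi a]
  refine ⟨I.ncard, ?_, spannedByCacti_of_matching (fun w hw => hAdj _ _ (hpred w hw)) hinj
    fun R hR hRI => ?_⟩
  · choose i hi hi' using hB
    have hsub : I ⊆ Set.range i := fun x ⟨a, ha⟩ => ⟨a, (hi' a x ha).symm⟩
    calc I.ncard ≤ (Set.range i).ncard := Set.ncard_le_ncard hsub
      _ ≤ p := by
        rw [← Set.image_univ]
        refine (Set.ncard_image_le).trans ?_
        simp
  · obtain ⟨v, hv, w, hw, hvw⟩ := hctrl.exists_edge_into hR fun w hw => hIB w (hRI w hw)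
    exact ⟨v, hv, w, hw, hAdj _ _ hvw⟩

theorem spannedByCacti_card {n : ℕ} (D : Digraph (Fin n)) : SpannedByCacti D n := by
  refine ⟨fun a => {x | x ∈ [a]}, _, id, id,
    fun a => IsCactus.stem [a] a a ⟨by simp, by simp, by simp⟩ rfl rfl, fun a b hab => ?_, ?_⟩
  · simpa using hab
  · ext x
    simp

end StructuralControl

theorem theorem2 (n : ℕ) (A : Matrix (Fin n) (Fin n) ℝ) :
    ∃ N : ℕ,
      IsLeast {p : ℕ | ∃ B : Matrix (Fin n) (Fin p) ℝ,
        StructuralControl.Dedicated B ∧ StructuralControl.StructurallyControllable A B} N ∧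
      IsLeast {k : ℕ |
        StructuralControl.SpannedByCacti (StructuralControl.stateDigraph A) k} N := by
  classical
  have hex : ∃ k, StructuralControl.SpannedByCacti (StructuralControl.stateDigraph A) k :=
    ⟨n, StructuralControl.spannedByCacti_card _⟩
  refine ⟨Nat.find hex, ⟨?_, ?_⟩, Nat.find_spec hex, fun k hk => Nat.find_min' hex hk⟩
  · exact StructuralControl.structurallyControllable_of_spannedByCacti (Nat.find_spec hex)
  · rintro p ⟨B, hB, hAB⟩
    obtain ⟨k, hkp, hk⟩ := StructuralControl.exists_spannedByCacti_le hB hAB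
    exact (Nat.find_min' hex hk).trans hkp
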